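/- Let $g:\mathbb R\to\mathbb R$ be Borel measurable, let $\sigma>0$ and $\eta\in(0,1)$, and let $P_\eta$ be the Markov kernel on $\mathbb R$ of the Euler–Maruyama scheme $\theta_{k+1}=\theta_k+\eta g(\theta_k)+\sqrt\eta\,\sigma\varepsilon_{k+1}$ with $(\varepsilon_k)_{k\ge 1}$ i.i.d. standard normal, i.e. $P_\eta(x,A)=\mathbb P(x+\eta g(x)+\sqrt{\eta}\,\sigma\varepsilon_1\in A)$. Let $\mathbb E_x$ be the expectation for the chain $(\theta_n)_{n\ge 0}$ started at $\theta_0=x$, let $\sigma_C=\inf\{n\ge1:\theta_n\in C\}\in\{1,2,\dots\}\cup\{\infty\}$, with $\delta^{\infty}=\infty$ for $\delta>1$, and let $\|\xi\|_{TV}=|\xi|(\mathbb R)$ for a finite signed measure $\xi$. A Borel set $C$ is *small* if there are an integer $m\ge1$ and a nonzero Borel measure $\mu$ with $P_\eta^m(x,A)\ge\mu(A)$ for all $x\in C$ and all Borel $A$. A Borel set $A$ is *accessible* if for every $x$ there is $n\ge1$ with $P_\eta^n(x,A)>0$. The kernel is *irreducible* if it has an accessible small set, and *positive* if it is irreducible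 and has an invariant probability measure. The period of an accessible small set $C$ is $\gcd\{n\ge1:\inf_{x\in C}P_\eta^n(x,C)>0\}$; the kernel is *aperiodic* if it is irreducible and every accessible small set has period $1$. Then the following statements are equivalent. 1. $P_\eta$ is uniformly geometrically ergodic: it admits an invariant probability measure $\pi_\eta$ for which there are $\delta>1$ and $\tau<\infty$ such that $\sup_{x\in\mathbb R}\|P_\eta^n(x,\cdot)-\pi_\eta\|_{TV}\le\tau\delta^{-n}$ for all $n\in\mathbb N=\{0,1,2,\dots\}$. 2. $P_\eta$ is positive and aperiodic, and there are a small set $C$ and a constant $\delta>1$ such that $\sup_{x\in\mathbb R}\mathbb E_x(\delta^{\sigma_C})<\infty$. 3. The whole state space $\mathbb R$ is small. -/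

import Mathlib

open MeasureTheory ProbabilityTheory
open scoped ENNReal NNReal

noncomputable section

namespace MarkovErgodic

variable {X : Type*} [MeasurableSpace X]

instance isMarkovKernel_pow (P : Kernel X X) [IsMarkovKernel P] (n : ℕ) :
    IsMarkovKernel (P ^ n) := by
  induction n with
  | zero => rw [pow_zero]; exact inferInstanceAs (IsMarkovKernel (Kernel.id : Kernel X X))
  | succ n ih => rw [pow_succ]; exact inferInstanceAs (IsMarkovKernel ((P ^ n) ∘ₖ P))

/-- The total variation norm `|μ - ν|(X)` of the signed measure `μ - ν`, where
`|ξ| = ξ₊ + ξ₋` comes from the Jordan decomposition. -/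
def tvNormSub (μ ν : Measure X) [IsFiniteMeasure μ] [IsFiniteMeasure ν] : ℝ :=
  (μ.toSignedMeasure - ν.toSignedMeasure).totalVariation.real Set.univ

/-- A measurable set `A` is accessible if from every state it is charged by some iterate
`P ^ n`, `n ≥ 1`. -/
def IsAccessible (P : Kernel X X) (A : Set X) : Prop :=
  MeasurableSet A ∧ ∀ x, ∃ n : ℕ, 1 ≤ n ∧ 0 < (P ^ n) x A

/-- A measurable set `C` is small if `P ^ m (x, ·) ≥ μ` for all `x ∈ C`, for some `m ≥ 1` and some
nonzero measure `μ`. -/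
def IsSmall (P : Kernel X X) (C : Set X) : Prop :=
  MeasurableSet C ∧ ∃ m : ℕ, 1 ≤ m ∧ ∃ μ : Measure X, μ ≠ 0 ∧
    ∀ x ∈ C, ∀ A : Set X, MeasurableSet A → μ A ≤ (P ^ m) x A

/-- A kernel is irreducible if it admits an accessible small set. -/
def IsIrred (P : Kernel X X) : Prop :=
  ∃ C : Set X, IsAccessible P C ∧ IsSmall P C

/-- The period of a set `C`: the greatest common divisor of all `n ≥ 1` with
`inf_{x ∈ C} P ^ n (x, C) > 0`. -/
def setPeriod (P : Kernel X X) (C : Set X) : ℕ :=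
  Nat.setGcd {n : ℕ | 1 ≤ n ∧ 0 < ⨅ x ∈ C, (P ^ n) x C}

/-- An irreducible kernel has period `d` if `d` is the common period of all its accessible small
sets. -/
def HasPeriod (P : Kernel X X) (d : ℕ) : Prop :=
  IsIrred P ∧ ∀ C : Set X, IsAccessible P C → IsSmall P C → setPeriod P C = d

/-- A kernel is aperiodic if it is irreducible with period one. -/
def IsAperiodic (P : Kernel X X) : Prop :=
  HasPeriod P 1

/-- A kernel is positive if it is irreducible and has an invariant probability measure. -/
def IsPositive (P : Kernel X X) : Prop :=
  IsIrred P ∧ ∃ π : Measure X, IsProbabilityMeasure π ∧ P.Invariant π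

/-- Uniform geometric ergodicity in total variation. -/
def IsUniformlyGeometricallyErgodic (P : Kernel X X) [IsMarkovKernel P] : Prop :=
  ∃ (π : Measure X) (_ : IsProbabilityMeasure π), P.Invariant π ∧
    ∃ δ τ : ℝ, 1 < δ ∧ ∀ (n : ℕ) (x : X), tvNormSub ((P ^ n) x) π ≤ τ * (δ ^ n)⁻¹

/-- The law on the canonical space `ℕ → X` of the Markov chain with kernel `P` started
at `x`. -/
def chainLaw (P : Kernel X X) [IsMarkovKernel P] (x : X) : Measure (ℕ → X) :=
  Kernel.traj (X := fun _ : ℕ => X)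
    (fun n => P.comap (fun h : (i : Finset.Iic n) → X => h ⟨n, Finset.mem_Iic.2 le_rfl⟩)
      (measurable_pi_apply _)) 0 (fun _ => x)

/-- The first return time `inf {n ≥ 1 | ω n ∈ C}`, infinite if there is no such `n`. -/
def returnTime (C : Set X) (ω : ℕ → X) : ℕ∞ :=
  hittingAfter (fun (n : ℕ) (ω' : ℕ → X) => ω' n) C 1 ω

/-- The power `δ ^ k` for `δ > 1` and an extended natural number `k`, with `δ ^ ∞ = ∞`. -/
def geomPow (δ : ℝ) : ℕ∞ → ℝ≥0∞
  | ⊤ => ⊤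
  | (n : ℕ) => ENNReal.ofReal (δ ^ n)

/-- The expectation of `δ ^ σ_C` for the chain started at `x`. -/
def expReturn (P : Kernel X X) [IsMarkovKernel P] (δ : ℝ) (C : Set X) (x : X) : ℝ≥0∞ :=
  ∫⁻ ω, geomPow δ (returnTime C ω) ∂(chainLaw P x)

/-- The Markov kernel of the Euler-Maruyama scheme with drift `g`, step size `η` and noise level
`σ`: from `x` the chain moves to `x + η g(x) + √η σ Z` with `Z` standard normal. -/
def emKernel (g : ℝ → ℝ) (hg : Measurable g) (η σ : ℝ) : Kernel ℝ ℝ where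
  toFun x := (gaussianReal 0 1).map (fun z => x + η * g x + √η * σ * z)
  measurable' := by
    refine Measure.measurable_of_measurable_coe _ fun A hA => ?_
    have hf : Measurable fun p : ℝ × ℝ => p.1 + η * g p.1 + √η * σ * p.2 := by fun_prop
    have hm : ∀ x : ℝ, Measurable fun z : ℝ => x + η * g x + √η * σ * z := fun x => by fun_prop
    have := measurable_measure_prodMk_left (ν := gaussianReal 0 1) (hf hA)
    convert this using 2 with x
    rw [Measure.map_apply (hm x) hA]
    rfl

instance (g : ℝ → ℝ) (hg : Measurable g) (η σ : ℝ) : IsMarkovKernel (emKernel g hg η σ) :=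
  ⟨fun x => Measure.isProbabilityMeasure_map (by fun_prop)⟩

end MarkovErgodic

end

/-! The Gaussian noise gives `f x • ρ ≤ P x` for every `x`, where `ρ` is Lebesgue measure on `[0,
1]` and `f > 0` need not be bounded away from zero. Each implication into 3 makes this bound uniform
in `x`. 1 → 3: `π` charges a level set of `f` bounded away from zero; by uniform convergence the
chain is there at one fixed time with probability bounded below, and one more step minorises
(`isSmall_univ_of_uniformlyGeometricallyErgodic`). 2 → 3: the moment bound forces a visit to `C`
within bounded time, and the one-step bound brings the varying visit times to a common one
(`isSmall_univ_of_expReturn_lt_top`). 3 → 1 is Doeblin's contraction of oscillations. For 3 → 2 take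
`C` to be the whole space; aperiodicity follows from 1. -/

namespace MarkovErgodic

variable {X : Type*} [MeasurableSpace X] {P : Kernel X X}

/-! ### Total variation and oscillation -/

/-- On a Hahn decomposition only one Jordan part lives on each piece, so the norm is a sum of two
set differences; hence the factor 2. -/
lemma tvNormSub_le {μ ν : Measure X} [IsFiniteMeasure μ] [IsFiniteMeasure ν] {c : ℝ}
    (h : ∀ A, MeasurableSet A → |μ.real A - ν.real A| ≤ c) : tvNormSub μ ν ≤ 2 * c := by
  unfold tvNormSub
  set s := μ.toSignedMeasure - ν.toSignedMeasure with hs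
  have hval : ∀ A, MeasurableSet A → s A = μ.real A - ν.real A := fun A hA => by
    simp [hs, Measure.toSignedMeasure_apply, hA]
  obtain ⟨S, hS, -, -, hpos, hneg⟩ := s.toJordanDecomposition.exists_compl_positive_negative
  have h1 := s.apply_eq_posPart_real_sub_negPart_real hS
  have h2 := s.apply_eq_posPart_real_sub_negPart_real hS.compl
  have h3 : s.totalVariation.real Set.univ
      = s.totalVariation.real S + s.totalVariation.real Sᶜ :=
    (measureReal_add_measureReal_compl hS).symm
  rw [hval _ hS] at h1
  rw [hval _ hS.compl] at h2
  have e1 : s.toJordanDecomposition.posPart.real S = 0 := by simp [measureReal_def, hpos]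
  have e2 : s.toJordanDecomposition.negPart.real Sᶜ = 0 := by simp [measureReal_def, hneg]
  rw [h3, SignedMeasure.totalVariation, measureReal_add_apply, measureReal_add_apply, e1, e2]
  have a1 := (abs_le.1 (h S hS)).1
  have a2 := (abs_le.1 (h Sᶜ hS.compl)).2
  linarith

lemma real_sub_le_tvNormSub (μ ν : Measure X) [IsFiniteMeasure μ] [IsFiniteMeasure ν]
    {A : Set X} (hA : MeasurableSet A) : ν.real A - tvNormSub μ ν ≤ μ.real A := by
  have h := (μ.toSignedMeasure - ν.toSignedMeasure).norm_le_totalVariation A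
  have h' : (μ.toSignedMeasure - ν.toSignedMeasure).totalVariation.real A ≤ tvNormSub μ ν :=
    measureReal_mono (Set.subset_univ A)
  have hv : (μ.toSignedMeasure - ν.toSignedMeasure) A = μ.real A - ν.real A := by
    simp [Measure.toSignedMeasure_apply, hA]
  rw [hv, Real.norm_eq_abs] at h
  have := (abs_le.1 (h.trans h')).1
  linarith

/-- Integrals of a function of oscillation at most `c` against two measures of equal mass. -/
lemma lintegral_le_lintegral_add_of_osc {f : X → ℝ≥0∞} {c : ℝ≥0∞} (h : ∀ x y, f x ≤ f y + c)
    {α β : Measure X} (hαβ : α Set.univ = β Set.univ) :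
    ∫⁻ x, f x ∂α ≤ ∫⁻ x, f x ∂β + c * α Set.univ := by
  rcases isEmpty_or_nonempty X with hX | hX
  · simp [Measure.eq_zero_of_isEmpty α]
  calc ∫⁻ x, f x ∂α ≤ ∫⁻ _, (⨅ y, f y) + c ∂α := by
        refine lintegral_mono fun x => ?_
        rw [ENNReal.iInf_add]
        exact le_iInf fun y => h x y
    _ = ∫⁻ _, (⨅ y, f y) ∂β + c * α Set.univ := by simp [add_mul, hαβ]
    _ ≤ _ := by
        gcongr with x
        exact iInf_le _ x

/-! ### Minorised kernels: contraction and invariant measure -/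

section Doeblin

variable {κ : Kernel X X} {μ : Measure X}

/-- The remainder of a kernel after subtraction of a common lower bound. -/
noncomputable def residual (κ : Kernel X X) (μ : Measure X) [IsFiniteMeasure μ]
    (h : ∀ x, μ ≤ κ x) : Kernel X X where
  toFun x := κ x - μ
  measurable' := by
    refine Measure.measurable_of_measurable_coe _ fun A hA => ?_
    simp_rw [Measure.sub_apply hA (h _)]
    exact (κ.measurable_coe hA).sub_const _

variable [IsFiniteMeasure μ] (h : ∀ x, μ ≤ κ x)

lemma add_residual (x : X) : μ + residual κ μ h x = κ x := by
  rw [add_comm]; exact Measure.sub_add_cancel_of_le (h x)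

/-- The successive images of `μ` under the residual kernel. -/
noncomputable def residualIter : ℕ → Measure X
  | 0 => μ
  | k + 1 => (residualIter k).bind (residual κ μ h)

/-- One step of `κ` regenerates `μ` with the current mass and passes the rest on to the next
iterate. -/
lemma bind_residualIter (k : ℕ) {A : Set X} (hA : MeasurableSet A) :
    (residualIter h k).bind κ A
      = residualIter h k Set.univ * μ A + residualIter h (k + 1) A := by
  rw [Measure.bind_apply hA (Kernel.aemeasurable _), residualIter,
    Measure.bind_apply hA (Kernel.aemeasurable _)]
  simp_rw [← add_residual h, Measure.add_apply]
  rw [lintegral_add_left measurable_const]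
  simp [mul_comm]

variable [IsMarkovKernel κ]

lemma residual_univ (x : X) : residual κ μ h x Set.univ = 1 - μ Set.univ := by
  change (κ x - μ) Set.univ = _
  rw [Measure.sub_apply .univ (h x), measure_univ]

include h in
-- Split the first step: the `μ` part is common to `x` and `y`, and the residual parts have equal
-- mass `1 - μ(X)`, which is the contraction factor.
lemma pow_osc_le (k : ℕ) {A : Set X} (hA : MeasurableSet A) (x y : X) :
    (κ ^ k) x A ≤ (κ ^ k) y A + (1 - μ Set.univ) ^ k := by
  induction k generalizing x y with
  | zero => exact prob_le_one.trans (by simp)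
  | succ k ih =>
    have key : ∀ z, (κ ^ (k + 1)) z A
        = ∫⁻ w, (κ ^ k) w A ∂μ + ∫⁻ w, (κ ^ k) w A ∂(residual κ μ h z) := fun z => by
      rw [add_comm k 1, Kernel.pow_add_apply_eq_lintegral _ _ _ _ hA, pow_one,
        ← lintegral_add_measure, add_residual]
    rw [key x, key y, add_assoc]
    gcongr
    refine (lintegral_le_lintegral_add_of_osc ih
      ((residual_univ h x).trans (residual_univ h y).symm)).trans ?_
    rw [residual_univ, pow_succ]

lemma residualIter_univ (k : ℕ) :
    residualIter h k Set.univ = μ Set.univ * (1 - μ Set.univ) ^ k := by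
  induction k with
  | zero => simp [residualIter]
  | succ k ih =>
    rw [residualIter, Measure.bind_apply .univ (Kernel.aemeasurable _)]
    simp [residual_univ, ih, pow_succ]; ring

include h in
/-- A minorised kernel has an invariant probability measure. -/
lemma exists_invariant_of_minorized (hμ : μ ≠ 0) :
    ∃ π : Measure X, IsProbabilityMeasure π ∧ κ.Invariant π := by
  have hμ0 : μ Set.univ ≠ 0 := by simpa using hμ
  have hX : Nonempty X := by
    by_contra hX
    rw [not_nonempty_iff] at hX
    exact hμ (Measure.eq_zero_of_isEmpty μ)
  have hμ1 : μ Set.univ ≤ 1 := by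
    obtain ⟨x⟩ := hX
    exact (h x _).trans prob_le_one
  have hsum : ∑' k, residualIter h k Set.univ = 1 := by
    simp_rw [residualIter_univ, ENNReal.tsum_mul_left, ENNReal.tsum_geometric,
      ENNReal.sub_sub_cancel ENNReal.one_ne_top hμ1]
    exact ENNReal.mul_inv_cancel hμ0 (hμ1.trans_lt ENNReal.one_lt_top).ne
  -- The stationary measure sums over the time elapsed since the last regeneration; invariance is a
  -- shift of the index, the regenerated `μ` being the zeroth term.
  refine ⟨Measure.sum (residualIter h), ⟨?_⟩, ?_⟩
  · rw [Measure.sum_apply _ .univ, hsum]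
  · refine Measure.ext fun A hA => ?_
    rw [Measure.bind_apply hA (Kernel.aemeasurable _), lintegral_sum_measure,
      Measure.sum_apply _ hA]
    have : ∀ k, ∫⁻ x, κ x A ∂(residualIter h k)
        = residualIter h k Set.univ * μ A + residualIter h (k + 1) A := fun k => by
      rw [← bind_residualIter h k hA, Measure.bind_apply hA (Kernel.aemeasurable _)]
    simp_rw [this]
    rw [ENNReal.tsum_add, ENNReal.tsum_mul_right, hsum, one_mul,
      tsum_eq_zero_add' (f := fun k => residualIter h k A) ENNReal.summable]
    rfl

end Doeblin

/-! ### Doeblin's theorem -/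

lemma Invariant.lintegral_pow {π : Measure X} (hπ : P.Invariant π) (n : ℕ) {A : Set X}
    (hA : MeasurableSet A) : ∫⁻ x, (P ^ n) x A ∂π = π A := by
  induction n with
  | zero =>
    rw [pow_zero]
    have : ∀ x, (1 : Kernel X X) x A = A.indicator 1 x := fun x => Measure.dirac_apply' x hA
    simp_rw [this]
    exact lintegral_indicator_one hA
  | succ n ih =>
    have := hπ.def
    rw [← ih]
    nth_rw 2 [← this]
    rw [Measure.lintegral_bind (Kernel.aemeasurable _) (Kernel.measurable_coe _ hA).aemeasurable]
    simp_rw [add_comm n 1, Kernel.pow_add_apply_eq_lintegral P 1 n _ hA, pow_one]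

/-- The `r` initial steps only average, which cannot increase the oscillation. -/
lemma pow_mul_add_osc_le [IsMarkovKernel P] {m : ℕ} {μ : Measure X} [IsFiniteMeasure μ]
    (h : ∀ x, μ ≤ (P ^ m) x) (k r : ℕ) {A : Set X} (hA : MeasurableSet A) (x y : X) :
    (P ^ (m * k + r)) x A ≤ (P ^ (m * k + r)) y A + (1 - μ Set.univ) ^ k := by
  rw [add_comm, Kernel.pow_add_apply_eq_lintegral _ _ _ _ hA,
    Kernel.pow_add_apply_eq_lintegral _ _ _ _ hA, pow_mul]
  refine (lintegral_le_lintegral_add_of_osc (pow_osc_le h k hA)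
    (α := (P ^ r) x) (β := (P ^ r) y) (by simp)).trans ?_
  simp

/-- An invariant probability measure of a minorised iterate is invariant for the kernel itself. -/
lemma invariant_of_invariant_pow [IsMarkovKernel P] {m : ℕ} {μ : Measure X} [IsFiniteMeasure μ]
    (hμ : μ ≠ 0) (h : ∀ x, μ ≤ (P ^ m) x) {π : Measure X} [IsProbabilityMeasure π]
    (hπ : (P ^ m).Invariant π) : P.Invariant π := by
  -- Uniqueness for `P ^ m`: two invariant laws differ by at most `(1 - μ(X)) ^ k` for every `k`.
  have hle : ∀ α β : Measure X, IsProbabilityMeasure α → IsProbabilityMeasure β →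
      (P ^ m).Invariant α → (P ^ m).Invariant β → α ≤ β := by
    intro α β hα hβ hiα hiβ
    refine Measure.le_intro fun A hA _ => ?_
    have hk : ∀ k : ℕ, α A ≤ β A + (1 - μ Set.univ) ^ k := fun k => by
      rw [← Invariant.lintegral_pow hiα k hA, ← Invariant.lintegral_pow hiβ k hA]
      refine (lintegral_le_lintegral_add_of_osc (pow_osc_le h k hA)
        (α := α) (β := β) (by simp)).trans ?_
      simp
    have hlt : 1 - μ Set.univ < 1 :=
      ENNReal.sub_lt_self ENNReal.one_ne_top one_ne_zero (by simpa using hμ)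
    have ht := (ENNReal.tendsto_pow_atTop_nhds_zero_of_lt_one hlt).const_add (β A)
    rw [add_zero] at ht
    exact ge_of_tendsto' ht hk
  have hb : IsProbabilityMeasure (π.bind P) := by
    constructor
    rw [Measure.bind_apply .univ (Kernel.aemeasurable _)]
    simp
  -- `P` commutes with `P ^ m`, so it preserves invariance under `P ^ m`.
  have hinv : (P ^ m).Invariant (π.bind P) := by
    change (P ^ m) ∘ₘ (P ∘ₘ π) = P ∘ₘ π
    rw [Measure.comp_assoc]
    have : (P ^ m) ∘ₖ P = P ∘ₖ (P ^ m) := (pow_succ P m).symm.trans (pow_succ' P m)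
    rw [this, ← Measure.comp_assoc]
    congr 1
  exact le_antisymm (hle _ _ hb inferInstance hinv hπ) (hle _ _ inferInstance hb hπ hinv)

/-- Doeblin's theorem: if the whole space is small, the kernel is uniformly geometrically
ergodic. -/
theorem uniformlyGeometricallyErgodic_of_isSmall_univ [IsMarkovKernel P] [Nonempty X]
    (h : IsSmall P Set.univ) : IsUniformlyGeometricallyErgodic P := by
  obtain ⟨-, m, hm, μ, hμ, hle⟩ := h
  have h : ∀ x, μ ≤ (P ^ m) x := fun x => Measure.le_intro fun A hA _ => hle x trivial A hA
  obtain ⟨x₀⟩ := ‹Nonempty X›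
  have : IsFiniteMeasure μ := isFiniteMeasure_of_le _ (h x₀)
  obtain ⟨π, hπ, hinv⟩ := exists_invariant_of_minorized h hμ
  have hinv : P.Invariant π := invariant_of_invariant_pow hμ h hinv
  have hμ0 : 0 < μ.real Set.univ := by
    rw [measureReal_def, ENNReal.toReal_pos_iff]
    exact ⟨pos_iff_ne_zero.2 (by simpa using hμ), measure_lt_top _ _⟩
  -- The `1 / 2` keeps `q` invertible when `μ` has full mass.
  set q : ℝ := max (1 - μ.real Set.univ) (1 / 2) with hq
  have hq0 : 0 < q := lt_max_of_lt_right (by norm_num)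
  have hq1 : q < 1 := max_lt (by linarith) (by norm_num)
  have hqe : 1 - μ Set.univ ≤ ENNReal.ofReal q := by
    rw [← ENNReal.ofReal_toReal (measure_ne_top μ Set.univ), ← ENNReal.ofReal_one,
      ← ENNReal.ofReal_sub _ ENNReal.toReal_nonneg]
    exact ENNReal.ofReal_le_ofReal (le_max_left _ _)
  have hm0 : (0 : ℝ) < m := by exact_mod_cast hm
  have hosc : ∀ (n : ℕ) (x : X) (A : Set X), MeasurableSet A →
      |((P ^ n) x).real A - π.real A| ≤ q ^ (n / m) := by
    intro n x A hA
    have hpow : (1 - μ Set.univ) ^ (n / m) ≤ ENNReal.ofReal (q ^ (n / m)) := by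
      rw [ENNReal.ofReal_pow hq0.le]; gcongr
    have hosc : ∀ y z, (P ^ n) y A ≤ (P ^ n) z A + ENNReal.ofReal (q ^ (n / m)) := fun y z => by
      have := pow_mul_add_osc_le h (n / m) (n % m) hA y z
      rw [Nat.div_add_mod] at this
      exact this.trans (by gcongr)
    have h1 : (P ^ n) x A ≤ π A + ENNReal.ofReal (q ^ (n / m)) := by
      have := lintegral_le_lintegral_add_of_osc hosc (α := Measure.dirac x) (β := π) (by simp)
      rwa [lintegral_dirac' _ (Kernel.measurable_coe _ hA), Invariant.lintegral_pow hinv n hA,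
        measure_univ, mul_one] at this
    have h2 : π A ≤ (P ^ n) x A + ENNReal.ofReal (q ^ (n / m)) := by
      have := lintegral_le_lintegral_add_of_osc hosc (α := π) (β := Measure.dirac x) (by simp)
      rwa [lintegral_dirac' _ (Kernel.measurable_coe _ hA), Invariant.lintegral_pow hinv n hA,
        measure_univ, mul_one] at this
    have toR : ∀ α β : Measure X, IsProbabilityMeasure α → IsProbabilityMeasure β →
        α A ≤ β A + ENNReal.ofReal (q ^ (n / m)) → α.real A ≤ β.real A + q ^ (n / m) := by
      intro α β _ _ hab
      have := ENNReal.toReal_mono (by finiteness) hab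
      rwa [ENNReal.toReal_add (by finiteness) (by finiteness),
        ENNReal.toReal_ofReal (by positivity)] at this
    have h1' := toR _ _ inferInstance inferInstance h1
    have h2' := toR _ _ inferInstance inferInstance h2
    exact abs_le.2 ⟨by linarith, by linarith⟩
  -- Since `⌊n / m⌋ ≥ n / m - 1`, the rate is `q ^ (1 / m)` per step, with rounding loss `q⁻¹` in
  -- the constant.
  refine ⟨π, hπ, hinv, q⁻¹ ^ (1 / m : ℝ), 2 * q⁻¹, Real.one_lt_rpow (one_lt_inv₀ hq0 |>.2 hq1)
    (by positivity), fun n x => (tvNormSub_le (hosc n x)).trans ?_⟩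
  rw [mul_assoc]
  refine mul_le_mul_of_nonneg_left ?_ (by norm_num)
  have e1 : ((q⁻¹ ^ (1 / m : ℝ)) ^ n)⁻¹ = q ^ ((n : ℝ) / m) := by
    rw [← Real.rpow_natCast, ← Real.rpow_mul (by positivity), Real.inv_rpow hq0.le, inv_inv]
    congr 1; field_simp
  have e2 : q⁻¹ * q ^ ((n : ℝ) / m) = q ^ ((n : ℝ) / m - 1) := by
    rw [Real.rpow_sub_one hq0.ne', mul_comm, div_eq_mul_inv _ q]
  rw [e1, e2, ← Real.rpow_natCast]
  refine Real.rpow_le_rpow_of_exponent_ge hq0 hq1.le ?_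
  have : (n : ℝ) < m * ((n / m : ℕ) + 1) := by exact_mod_cast Nat.lt_mul_div_succ n hm
  rw [sub_le_iff_le_add, div_le_iff₀ hm0]
  linarith

/-! ### The canonical chain and return times -/

lemma chainLaw_map_succ [IsMarkovKernel P] (x : X) (n : ℕ) :
    (chainLaw P x).map (fun ω => ω (n + 1)) = ((chainLaw P x).map (fun ω => ω n)).bind P := by
  unfold chainLaw
  set κ : (n : ℕ) → Kernel ((i : Finset.Iic n) → X) X :=
    fun n => P.comap (fun h : (i : Finset.Iic n) → X => h ⟨n, Finset.mem_Iic.2 le_rfl⟩)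
      (measurable_pi_apply _) with hκ
  have h1 := Kernel.traj_comp_partialTraj (X := fun _ : ℕ => X) (κ := κ) (Nat.zero_le n)
  have h2 := Kernel.map_traj_succ_self (X := fun _ : ℕ => X) (κ := κ) (a := n)
  have hlast : Measurable fun h : (i : Finset.Iic n) → X => h ⟨n, Finset.mem_Iic.2 le_rfl⟩ :=
    measurable_pi_apply _
  refine Measure.ext fun A hA => ?_
  have hfr := Kernel.traj_map_frestrictLe_apply (X := fun _ : ℕ => X) (κ := κ) 0 n (fun _ => x)
  rw [← Kernel.map_apply _ (measurable_pi_apply _)]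
  nth_rw 1 [← h1]
  rw [Kernel.map_comp, h2, Kernel.comp_apply, Measure.bind_apply hA (Kernel.aemeasurable _),
    ← hfr, lintegral_map (Kernel.measurable_coe _ hA) (by fun_prop),
    Measure.bind_apply hA (Kernel.aemeasurable _),
    lintegral_map (Kernel.measurable_coe _ hA) (by fun_prop)]
  rfl

lemma chainLaw_map_eval [IsMarkovKernel P] (x : X) (n : ℕ) :
    (chainLaw P x).map (fun ω => ω (n + 1)) = (P ^ (n + 1)) x := by
  induction n with
  | zero =>
    simp only [zero_add, pow_one]
    rw [chainLaw, ← Kernel.map_apply _ (by fun_prop), Kernel.map_traj_succ_self (a := 0)]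
    rfl
  | succ n ih =>
    rw [chainLaw_map_succ, ih, pow_succ' P (n + 1)]
    rfl

lemma chainLaw_preimage [IsMarkovKernel P] (x : X) {n : ℕ} (hn : 1 ≤ n) {A : Set X}
    (hA : MeasurableSet A) : chainLaw P x {ω | ω n ∈ A} = (P ^ n) x A := by
  obtain ⟨k, rfl⟩ := Nat.exists_eq_add_of_le' hn
  rw [← chainLaw_map_eval x k, Measure.map_apply (by fun_prop) hA]
  rfl

instance [IsMarkovKernel P] (x : X) : IsProbabilityMeasure (chainLaw P x) := by
  unfold chainLaw; infer_instance

lemma geomPow_ge {δ : ℝ} (hδ : 1 < δ) {N : ℕ} {t : ℕ∞} (h : N ≤ t) :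
    ENNReal.ofReal (δ ^ N) ≤ geomPow δ t := by
  cases t with
  | top => exact le_top
  | coe n => exact ENNReal.ofReal_le_ofReal (pow_le_pow_right₀ hδ.le (by exact_mod_cast h))

/-- The return time exceeds `N` exactly when the chain avoids `C` at times `1, …, N`;
its geometric moment bounds the probability of this. -/
lemma mul_avoid_le_expReturn [IsMarkovKernel P] {δ : ℝ} (hδ : 1 < δ) {C : Set X}
    (hC : MeasurableSet C) (N : ℕ) (x : X) :
    ENNReal.ofReal (δ ^ N) * chainLaw P x {ω | ∀ k ∈ Finset.Icc 1 N, ω k ∉ C}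
      ≤ expReturn P δ C x := by
  have hm : MeasurableSet {ω : ℕ → X | ∀ k ∈ Finset.Icc 1 N, ω k ∉ C} := by
    rw [show {ω : ℕ → X | ∀ k ∈ Finset.Icc 1 N, ω k ∉ C}
      = ⋂ k ∈ Finset.Icc 1 N, (fun ω => ω k) ⁻¹' Cᶜ by ext; simp]
    exact Finset.measurableSet_biInter _ fun k _ => measurable_pi_apply k hC.compl
  rw [← lintegral_indicator_const hm]
  refine lintegral_mono fun ω => ?_
  by_cases hω : ω ∈ {ω : ℕ → X | ∀ k ∈ Finset.Icc 1 N, ω k ∉ C}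
  · rw [Set.indicator_of_mem hω]
    refine geomPow_ge hδ ?_
    by_contra! hlt
    obtain ⟨j, hj, hjC⟩ := hittingAfter_lt_iff.1 hlt
    exact hω j (Finset.mem_Icc.2 ⟨hj.1, hj.2.le⟩) hjC
  · rw [Set.indicator_of_notMem hω]
    exact zero_le

lemma expReturn_univ [IsMarkovKernel P] (δ : ℝ) (x : X) :
    expReturn P δ Set.univ x = ENNReal.ofReal δ := by
  have : ∀ ω : ℕ → X, geomPow δ (returnTime Set.univ ω) = ENNReal.ofReal δ := fun ω => by
    have : returnTime Set.univ ω = ((1 : ℕ) : ℕ∞) := by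
      unfold returnTime; rw [hittingAfter_univ]; rfl
    rw [this]
    change ENNReal.ofReal (δ ^ 1) = _
    rw [pow_one]
  unfold expReturn
  simp [this]

/-- If the return time to `C` has a uniformly bounded geometric moment then `C` is hit within a
bounded time with probability bounded below. -/
lemma exists_hit_of_expReturn_lt_top [IsMarkovKernel P] {δ : ℝ} (hδ : 1 < δ) {C : Set X}
    (hC : MeasurableSet C) (h : (⨆ x, expReturn P δ C x) < ⊤) :
    ∃ (N : ℕ) (ε : ℝ≥0∞), ε ≠ 0 ∧ ∀ x, ∃ k ∈ Finset.Icc 1 N, ε ≤ (P ^ k) x C := by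
  set M := ⨆ x, expReturn P δ C x with hM
  -- With `δ ^ N > 2M`, Markov's inequality bounds the probability of avoiding `C` up to time `N` by
  -- 1/2. If all `N` hitting probabilities were below `1 / (2(N + 1))`, the union bound would leave
  -- total mass less than 1.
  obtain ⟨N, hN⟩ := pow_unbounded_of_one_lt (2 * M.toReal) hδ
  refine ⟨N, (2 * (N + 1) : ℝ≥0∞)⁻¹, ENNReal.inv_ne_zero.2 (by finiteness), fun x => ?_⟩
  by_contra! hlt
  set U := {ω : ℕ → X | ∀ k ∈ Finset.Icc 1 N, ω k ∉ C} with hU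
  have havoid : chainLaw P x U ≤ 2⁻¹ := by
    have h1 := (mul_avoid_le_expReturn hδ hC N x).trans (le_iSup (expReturn P δ C) x)
    by_contra! h2
    have hpos : ENNReal.ofReal (δ ^ N) ≠ 0 := by
      simp only [ne_eq, ENNReal.ofReal_eq_zero, not_le]; positivity
    have h3 : ENNReal.ofReal (δ ^ N) * 2⁻¹ < M :=
      ((ENNReal.mul_lt_mul_iff_right hpos ENNReal.ofReal_ne_top).2 h2).trans_le h1
    have h4 := (ENNReal.toReal_lt_toReal (by finiteness) h.ne).2 h3
    rw [ENNReal.toReal_mul, ENNReal.toReal_ofReal (by positivity)] at h4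
    simp at h4
    linarith
  have hhit : chainLaw P x Uᶜ ≤ ∑ k ∈ Finset.Icc 1 N, (P ^ k) x C := by
    have : Uᶜ ⊆ ⋃ k ∈ Finset.Icc 1 N, {ω : ℕ → X | ω k ∈ C} := by
      intro ω hω
      simpa [hU, and_assoc] using hω
    refine (measure_mono this).trans ((measure_biUnion_finset_le _ _).trans ?_)
    exact Finset.sum_le_sum fun k hk => (chainLaw_preimage x (Finset.mem_Icc.1 hk).1 hC).le
  have hsum : ∑ k ∈ Finset.Icc 1 N, (P ^ k) x C ≤ N * (2 * (N + 1) : ℝ≥0∞)⁻¹ := by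
    refine (Finset.sum_le_sum fun k hk => (hlt k hk).le).trans ?_
    simp
  have hlt2 : (N : ℝ≥0∞) * (2 * (N + 1) : ℝ≥0∞)⁻¹ < 2⁻¹ := by
    rw [ENNReal.mul_inv (by simp) (by simp), mul_left_comm]
    nth_rw 2 [← mul_one (2⁻¹ : ℝ≥0∞)]
    refine (ENNReal.mul_lt_mul_iff_right (by simp) (by simp)).2 ?_
    rw [← div_eq_mul_inv]
    refine ENNReal.div_lt_of_lt_mul ?_
    rw [one_mul]
    exact_mod_cast Nat.lt_succ_self N
  have htot : (1 : ℝ≥0∞) ≤ chainLaw P x U + chainLaw P x Uᶜ := by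
    rw [← measure_univ (μ := chainLaw P x), ← Set.union_compl_self U]
    exact measure_union_le _ _
  have hfin : chainLaw P x U + chainLaw P x Uᶜ < 2⁻¹ + 2⁻¹ :=
    ENNReal.add_lt_add_of_le_of_lt (by finiteness) havoid ((hhit.trans hsum).trans_lt hlt2)
  rw [ENNReal.inv_two_add_inv_two] at hfin
  exact absurd htot hfin.not_ge

/-! ### Consequences of uniform ergodicity -/

lemma eventually_le_pow_apply [IsMarkovKernel P] {π : Measure X} [IsProbabilityMeasure π]
    {δ τ : ℝ} (hδ : 1 < δ) (h : ∀ (n : ℕ) (x : X), tvNormSub ((P ^ n) x) π ≤ τ * (δ ^ n)⁻¹)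
    {C : Set X} (hC : MeasurableSet C) (hpos : π C ≠ 0) :
    ∃ ε : ℝ≥0∞, ε ≠ 0 ∧ ∃ N : ℕ, ∀ n ≥ N, ∀ x, ε ≤ (P ^ n) x C := by
  have hp : 0 < π.real C := ENNReal.toReal_pos hpos (measure_ne_top _ _)
  refine ⟨ENNReal.ofReal (π.real C / 2), by simpa using hp, ?_⟩
  have ht : Filter.Tendsto (fun n : ℕ => τ * (δ ^ n)⁻¹) Filter.atTop (nhds 0) := by
    have := (tendsto_pow_atTop_nhds_zero_of_lt_one (r := δ⁻¹) (by positivity)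
      (inv_lt_one_of_one_lt₀ hδ)).const_mul τ
    simpa using this
  obtain ⟨N, hN⟩ := Filter.eventually_atTop.1 (ht.eventually_lt_const (half_pos hp))
  refine ⟨N, fun n hn x => ?_⟩
  rw [← ENNReal.ofReal_toReal (measure_ne_top ((P ^ n) x) C)]
  refine ENNReal.ofReal_le_ofReal ?_
  have h1 := real_sub_le_tvNormSub ((P ^ n) x) π hC
  have h2 := h n x
  have h3 := hN n hn
  simp only [measureReal_def] at h1 h3 ⊢
  linarith

lemma Invariant.measure_ne_zero_of_isAccessible {π : Measure X} (hπ : P.Invariant π)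
    (hπ0 : π ≠ 0) {C : Set X} (hC : IsAccessible P C) : π C ≠ 0 := by
  intro h0
  have hae : ∀ n : ℕ, ∀ᵐ x ∂π, (P ^ n) x C = 0 := fun n => by
    have := Invariant.lintegral_pow hπ n hC.1
    rw [h0, lintegral_eq_zero_iff (Kernel.measurable_coe _ hC.1)] at this
    exact this
  have : ∀ᵐ x ∂π, False := by
    filter_upwards [ae_all_iff.2 hae] with x hx
    obtain ⟨n, -, hn⟩ := hC.2 x
    exact hn.ne' (hx n)
  exact hπ0 (by simpa using this)

/-- Uniformly geometrically ergodic irreducible kernels are aperiodic. -/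
lemma IsUniformlyGeometricallyErgodic.isAperiodic [IsMarkovKernel P]
    (h : IsUniformlyGeometricallyErgodic P) (hirr : IsIrred P) : IsAperiodic P := by
  obtain ⟨π, hπ, hinv, δ, τ, hδ, htv⟩ := h
  refine ⟨hirr, fun C hacc _ => ?_⟩
  obtain ⟨ε, hε, N, hN⟩ := eventually_le_pow_apply hδ htv hacc.1
    (Invariant.measure_ne_zero_of_isAccessible hinv (IsProbabilityMeasure.ne_zero π) hacc)
  have hmem : ∀ n ≥ N, 1 ≤ n → n ∈ {n : ℕ | 1 ≤ n ∧ 0 < ⨅ x ∈ C, (P ^ n) x C} :=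
    fun n hn h1 => ⟨h1, (pos_iff_ne_zero.2 hε).trans_le (le_iInf₂ fun x _ => hN n hn x)⟩
  -- The period divides two consecutive integers.
  have d1 := Nat.setGcd_dvd_of_mem (hmem (N + 1) (by omega) (by omega))
  have d2 := Nat.setGcd_dvd_of_mem (hmem (N + 2) (by omega) (by omega))
  have := Nat.dvd_sub d2 d1
  rw [show N + 2 - (N + 1) = 1 by omega] at this
  exact Nat.dvd_one.1 this

/-! ### From pointwise minorisation to smallness of the whole space -/

lemma mul_le_pow_add_apply (n k : ℕ) (x : X) {C A : Set X} {b : ℝ≥0∞}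
    (hA : MeasurableSet A) (h : ∀ y ∈ C, b ≤ (P ^ k) y A) :
    b * (P ^ n) x C ≤ (P ^ (n + k)) x A := by
  rw [Kernel.pow_add_apply_eq_lintegral _ _ _ _ hA]
  refine le_trans ?_ (mul_meas_ge_le_lintegral (Kernel.measurable_coe _ hA) b)
  gcongr
  exact h

lemma measure_smul_ne_zero {c : ℝ≥0∞} (hc : c ≠ 0) {ρ : Measure X} (hρ : ρ ≠ 0) :
    c • ρ ≠ 0 := by
  rw [ne_eq, ← Measure.measure_univ_eq_zero] at hρ ⊢
  simpa [hc] using hρ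

section Minorized

variable {ρ : Measure X} {f : X → ℝ≥0∞} (hf : Measurable f) (hf0 : ∀ x, f x ≠ 0)
  (hP : ∀ x, f x • ρ ≤ P x)
include hf hf0 hP

/-- The constant `∫ f dν` is nonzero because `f` vanishes nowhere. -/
lemma exists_smul_le_bind {ν : Measure X} (hν : ν ≠ 0) :
    ∃ c : ℝ≥0∞, c ≠ 0 ∧ c • ρ ≤ ν.bind P := by
  refine ⟨∫⁻ x, f x ∂ν, fun h0 => ?_, Measure.le_intro fun A hA _ => ?_⟩
  · rw [lintegral_eq_zero_iff hf] at h0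
    have : ∀ᵐ x ∂ν, False := h0.mono fun x hx => hf0 x hx
    exact hν (by simpa using this)
  · rw [Measure.bind_apply hA (Kernel.aemeasurable _), Measure.smul_apply, smul_eq_mul,
      ← lintegral_mul_const _ hf]
    exact lintegral_mono fun x => hP x A

lemma isSmall_univ_of_uniformlyGeometricallyErgodic [IsMarkovKernel P] (hρ : ρ ≠ 0)
    (h : IsUniformlyGeometricallyErgodic P) : IsSmall P Set.univ := by
  obtain ⟨π, hπ, hinv, δ, τ, hδ, htv⟩ := h
  obtain ⟨k, hk⟩ : ∃ k : ℕ, π {x | (k : ℝ≥0∞)⁻¹ ≤ f x} ≠ 0 := by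
    by_contra! h0
    have h1 : π (⋃ k : ℕ, {x | (k : ℝ≥0∞)⁻¹ ≤ f x}) = 0 := measure_iUnion_null h0
    have h2 : (⋃ k : ℕ, {x | (k : ℝ≥0∞)⁻¹ ≤ f x}) = Set.univ := by
      refine Set.eq_univ_of_forall fun x => ?_
      obtain ⟨n, hn⟩ := ENNReal.exists_inv_nat_lt (hf0 x)
      exact Set.mem_iUnion.2 ⟨n, hn.le⟩
    rw [h2, measure_univ] at h1
    exact one_ne_zero h1
  set C := {x | (k : ℝ≥0∞)⁻¹ ≤ f x} with hC
  obtain ⟨ε, hε, N, hN⟩ := eventually_le_pow_apply hδ htv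
    (measurableSet_le measurable_const hf : MeasurableSet C) hk
  refine ⟨.univ, N + 1, by omega, ((k : ℝ≥0∞)⁻¹ * ε) • ρ, ?_, fun x _ A hA => ?_⟩
  · exact measure_smul_ne_zero (mul_ne_zero (by simp) hε) hρ
  · have := mul_le_pow_add_apply (P := P) N 1 x (C := C) hA (b := (k : ℝ≥0∞)⁻¹ * ρ A)
      fun y hy => by
        rw [pow_one]
        refine le_trans ?_ (hP y A)
        rw [Measure.smul_apply, smul_eq_mul]
        gcongr
        exact hy
    refine le_trans ?_ this
    rw [Measure.smul_apply, smul_eq_mul, mul_right_comm]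
    gcongr
    exact hN N le_rfl x

lemma isSmall_univ_of_expReturn_lt_top [IsMarkovKernel P] (hρ : ρ ≠ 0) {C : Set X} {δ : ℝ}
    (hC : IsSmall P C) (hδ : 1 < δ) (h : (⨆ x, expReturn P δ C x) < ⊤) :
    IsSmall P Set.univ := by
  obtain ⟨hCm, m, hm, μ, hμ, hle⟩ := hC
  obtain ⟨N, ε, hε, hhit⟩ := exists_hit_of_expReturn_lt_top hδ hCm h
  have hν : ∀ k : ℕ, μ.bind (P ^ k) ≠ 0 := fun k h0 => hμ <| by
    have := Measure.bind_apply (m := μ) .univ (Kernel.aemeasurable (P ^ k))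
    rw [h0] at this
    simpa using this.symm
  choose c hc0 hc using fun k => exists_smul_le_bind hf hf0 hP (hν k)
  -- Finitely many waiting times `N - k` occur, so the minimum of their constants stays positive.
  set b := (Finset.range (N + 1)).inf c with hb
  have hb0 : b ≠ 0 := by
    rw [← pos_iff_ne_zero, hb, Finset.lt_inf_iff ENNReal.zero_lt_top]
    exact fun k _ => pos_iff_ne_zero.2 (hc0 k)
  -- A time independent of `k`: `k` steps to reach `C`, `m` to produce `μ`, `N - k` of waiting, and
  -- one last step to dominate `ρ`.
  refine ⟨.univ, N + m + 1, by omega, (b * ε) • ρ, ?_, fun x _ A hA => ?_⟩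
  · exact measure_smul_ne_zero (mul_ne_zero hb0 hε) hρ
  · obtain ⟨k, hk, hεk⟩ := hhit x
    have hkN := (Finset.mem_Icc.1 hk).2
    have hy : ∀ y ∈ C, b * ρ A ≤ (P ^ (m + (N - k + 1))) y A := fun y hy => by
      have hμy : μ ≤ (P ^ m) y := Measure.le_intro fun B hB _ => hle y hy B hB
      calc b * ρ A ≤ c (N - k) * ρ A := by
            gcongr
            exact Finset.inf_le (Finset.mem_range.2 (by omega))
        _ ≤ (μ.bind (P ^ (N - k))).bind P A := hc (N - k) A
        _ = ∫⁻ z, (P ^ (N - k + 1)) z A ∂μ := by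
            rw [Measure.bind_apply hA (Kernel.aemeasurable _),
              Measure.lintegral_bind (Kernel.aemeasurable _)
                (Kernel.measurable_coe _ hA).aemeasurable]
            simp_rw [Kernel.pow_succ_apply_eq_lintegral P _ _ hA]
        _ ≤ ∫⁻ z, (P ^ (N - k + 1)) z A ∂((P ^ m) y) := lintegral_mono' hμy le_rfl
        _ = _ := (Kernel.pow_add_apply_eq_lintegral _ _ _ _ hA).symm
    have := mul_le_pow_add_apply k (m + (N - k + 1)) x hA hy
    rw [show k + (m + (N - k + 1)) = N + m + 1 by omega] at this
    refine le_trans ?_ this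
    rw [Measure.smul_apply, smul_eq_mul, mul_right_comm]
    gcongr

end Minorized

/-- If the whole space is small, it is an accessible set. -/
lemma isAccessible_univ [IsMarkovKernel P] : IsAccessible P Set.univ :=
  ⟨.univ, fun _ => ⟨1, le_rfl, by simp⟩⟩

/-! ### The Euler–Maruyama kernel -/

/-- The Gaussian factor bounding the density of the Euler-Maruyama kernel from below
on `[0, 1]`. -/
noncomputable def emLowerBound (g : ℝ → ℝ) (η σ x : ℝ) : ℝ≥0∞ :=
  ENNReal.ofReal ((√(2 * Real.pi * (√η * σ) ^ 2))⁻¹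
    * Real.exp (-(1 + |x + η * g x|) ^ 2 / (2 * (√η * σ) ^ 2)))

lemma emKernel_apply_eq_gaussianReal (g : ℝ → ℝ) (hg : Measurable g) (η σ x : ℝ) :
    emKernel g hg η σ x
      = gaussianReal (x + η * g x) (.mk ((√η * σ) ^ 2) (sq_nonneg _)) := by
  have h : (fun z : ℝ => x + η * g x + √η * σ * z)
      = (fun y => (x + η * g x) + y) ∘ (fun z => (√η * σ) * z) := rfl
  change (gaussianReal 0 1).map (fun z => x + η * g x + √η * σ * z) = _
  rw [h, ← Measure.map_map (by fun_prop) (by fun_prop), gaussianReal_map_const_mul,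
    gaussianReal_map_const_add]
  simp only [mul_zero, zero_add, mul_one]

lemma emLowerBound_smul_le (g : ℝ → ℝ) (hg : Measurable g) {η σ : ℝ} (hη : 0 < η) (hσ : 0 < σ)
    (x : ℝ) : emLowerBound g η σ x • volume.restrict (Set.Icc (0 : ℝ) 1)
      ≤ emKernel g hg η σ x := by
  have hv : (.mk ((√η * σ) ^ 2) (sq_nonneg _) : ℝ≥0) ≠ 0 := by
    intro h
    exact (by positivity : (√η * σ) ^ 2 ≠ 0) (congrArg NNReal.toReal h)
  refine Measure.le_intro fun A hA _ => ?_
  rw [emKernel_apply_eq_gaussianReal, gaussianReal_apply _ hv, Measure.smul_apply, smul_eq_mul,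
    Measure.restrict_apply hA, ← setLIntegral_const]
  refine (setLIntegral_mono' (hA.inter measurableSet_Icc) fun y hy => ?_).trans
    (lintegral_mono_set Set.inter_subset_left)
  refine ENNReal.ofReal_le_ofReal ?_
  rw [gaussianPDFReal]
  refine mul_le_mul_of_nonneg_left (Real.exp_le_exp.2 ?_) (by positivity)
  change _ ≤ -(y - (x + η * g x)) ^ 2 / (2 * (√η * σ) ^ 2)
  -- For `y ∈ [0, 1]`, the distance from `y` to the mean `a` is at most `1 + |a|`.
  gcongr ?_ / _
  rw [neg_le_neg_iff]
  refine sq_le_sq' ?_ ?_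
  · have := le_abs_self (x + η * g x); linarith [hy.2.1]
  · have := neg_abs_le (x + η * g x); linarith [hy.2.2]

end MarkovErgodic

open MarkovErgodic in
theorem mainTheorem3 (g : ℝ → ℝ) (hg : Measurable g) (σ : ℝ) (hσ : 0 < σ) (η : ℝ)
    (hη : η ∈ Set.Ioo (0 : ℝ) 1) :
    List.TFAE [
      MarkovErgodic.IsUniformlyGeometricallyErgodic (MarkovErgodic.emKernel g hg η σ),
      MarkovErgodic.IsPositive (MarkovErgodic.emKernel g hg η σ) ∧
        MarkovErgodic.IsAperiodic (MarkovErgodic.emKernel g hg η σ) ∧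
        ∃ (C : Set ℝ) (δ : ℝ), MarkovErgodic.IsSmall (MarkovErgodic.emKernel g hg η σ) C ∧ 1 < δ ∧
          (⨆ x : ℝ, MarkovErgodic.expReturn (MarkovErgodic.emKernel g hg η σ) δ C x) < ⊤,
      MarkovErgodic.IsSmall (MarkovErgodic.emKernel g hg η σ) Set.univ] := by
  have hf : Measurable (emLowerBound g η σ) := by unfold emLowerBound; fun_prop
  have hf0 : ∀ x, emLowerBound g η σ x ≠ 0 := fun x => by
    have := hη.1
    rw [emLowerBound, ne_eq, ENNReal.ofReal_eq_zero, not_le]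
    positivity
  have hP := emLowerBound_smul_le g hg hη.1 hσ
  have hρ : volume.restrict (Set.Icc (0 : ℝ) 1) ≠ 0 := by simp
  tfae_have 1 → 3 := isSmall_univ_of_uniformlyGeometricallyErgodic hf hf0 hP hρ
  tfae_have 3 → 1 := uniformlyGeometricallyErgodic_of_isSmall_univ
  tfae_have 2 → 3
  | ⟨_, _, C, δ, hC, hδ, h⟩ => isSmall_univ_of_expReturn_lt_top hf hf0 hP hρ hC hδ h
  tfae_have 3 → 2 := fun h => by
    have herg := uniformlyGeometricallyErgodic_of_isSmall_univ h
    have hirr : IsIrred (emKernel g hg η σ) := ⟨Set.univ, isAccessible_univ, h⟩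
    obtain ⟨π, hπ, hinv, -⟩ := id herg
    -- Any `δ > 1` would do, since the return time to the whole space is 1.
    refine ⟨⟨hirr, π, hπ, hinv⟩, herg.isAperiodic hirr, Set.univ, 2, h, by norm_num, ?_⟩
    simp [expReturn_univ]
  tfae_finish
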